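/- For a finite group $G$ define its zeta function $$\zeta_G(s) = \sum_{H} |H|^{-s} \qquad (s \in \mathbb{C}),$$ where $H$ runs over all subgroups of $G$. **Theorem.** Within finite abelian groups, the zeta function $\zeta_G(s)$ determines the isomorphism class of $G$: if $G$ and $G'$ are finite abelian groups with $\zeta_G(s) = \zeta_{G'}(s)$ for all $s \in \mathbb{C}$, then $G \cong G'$. -/

import Mathlib

noncomputable section

/-- The zeta function of a finite group `G`: the function `s ↦ ∑_H |H|^{-s}` of a complex
variable `s`, where `H` runs over all subgroups of `G`. -/
def subgroupZeta (G : Type*) [Group G] [Finite G] (s : ℂ) : ℂ :=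
  letI : Fintype (Subgroup G) := Fintype.ofFinite (Subgroup G)
  ∑ H : Subgroup G, (Nat.card H : ℂ) ^ (-s)

end

open Function

/-! ### Power sums and fibre counting. -/

section Counting

/-! At `s = -k` the zeta function is the `k`-th power sum of the subgroup orders, so it determines
how many subgroups have each order `n`. By induction on `n` this gives the number of elements of
order `n`. A subgroup of order `n` and exponent `m < n` lies in the `m`-torsion, whose isomorphism
class is known because its element orders divide `m`. Subtracting these leaves the subgroups of
order and exponent `n`, the cyclic ones, each with `φ(n)` generators.

That element orders determine a finite abelian group (`nonempty_mulEquiv_of_card_orderOf_eq`)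
follows by counting homomorphisms: they fix `|Hom(A, G)|` for every finite abelian `A`, hence the
number of embeddings of `A`; taking `A = G` embeds `G` in `G'`. -/

theorem sum_comp_eq_sum_comp_of_pow_sums {α β : Type*} [Fintype α] [Fintype β] (f : α → ℂ)
    (g : β → ℂ) (h : ∀ k : ℕ, ∑ a, f a ^ k = ∑ b, g b ^ k) (P : Polynomial ℂ) :
    ∑ a, P.eval (f a) = ∑ b, P.eval (g b) := by
  simp only [Polynomial.eval_eq_sum_range]
  rw [Finset.sum_comm, Finset.sum_comm (s := (Finset.univ : Finset β))]
  simp only [← Finset.mul_sum, h]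

/-- Two finite families of complex numbers with the same power sums take every value equally
often. -/
theorem card_fiber_eq_of_pow_sums {α β : Type*} [Finite α] [Finite β] (f : α → ℂ) (g : β → ℂ)
    (h : ∀ k : ℕ, (letI := Fintype.ofFinite α; ∑ a, f a ^ k) =
      (letI := Fintype.ofFinite β; ∑ b, g b ^ k)) (z : ℂ) :
    Nat.card {a // f a = z} = Nat.card {b // g b = z} := by
  classical
  let := Fintype.ofFinite α
  let := Fintype.ofFinite β
  -- The polynomial with root set `S` kills every value except `z`, so summing it counts the fibre
  -- over `z`.
  set S : Finset ℂ := (Finset.univ.image f ∪ Finset.univ.image g).erase z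
  set P : Polynomial ℂ := ∏ w ∈ S, (Polynomial.X - Polynomial.C w)
  have hP : ∀ w, P.eval w = ∏ v ∈ S, (w - v) := fun w => by
    simp [P, Polynomial.eval_prod]
  have hz : P.eval z ≠ 0 := by
    rw [hP, Finset.prod_ne_zero_iff]
    intro w hw
    exact sub_ne_zero.2 (Finset.ne_of_mem_erase hw).symm
  have h0 : ∀ w ∈ S, P.eval w = 0 := fun w hw => by
    rw [hP]
    exact Finset.prod_eq_zero hw (sub_self w)
  have hf : ∀ a, P.eval (f a) = if f a = z then P.eval z else 0 := fun a => by
    split_ifs with ha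
    · rw [ha]
    · exact h0 _ (Finset.mem_erase.2 ⟨ha, by simp⟩)
  have hg : ∀ b, P.eval (g b) = if g b = z then P.eval z else 0 := fun b => by
    split_ifs with hb
    · rw [hb]
    · exact h0 _ (Finset.mem_erase.2 ⟨hb, by simp⟩)
  have key := sum_comp_eq_sum_comp_of_pow_sums f g h P
  simp only [hf, hg, ← Finset.sum_filter, Finset.sum_const, nsmul_eq_mul] at key
  have := mul_right_cancel₀ hz key
  rw [Nat.card_eq_fintype_card, Nat.card_eq_fintype_card, Fintype.card_subtype,
    Fintype.card_subtype]
  exact_mod_cast this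

theorem Nat.card_eq_sum_card_fiber {α ι : Type*} [Finite α] [Fintype ι] (f : α → ι) :
    Nat.card α = ∑ i, Nat.card {a // f a = i} := by
  rw [← Nat.card_sigma, Nat.card_congr (Equiv.sigmaFiberEquiv f)]

theorem Nat.card_eq_sum_card_of_mem {α ι : Type*} [Finite α] (f : α → ι) (s : Finset ι)
    (hf : ∀ a, f a ∈ s) : Nat.card α = ∑ i ∈ s, Nat.card {a // f a = i} := by
  rw [Nat.card_eq_sum_card_fiber (fun a => (⟨f a, hf a⟩ : s)),
    ← Finset.sum_coe_sort s (fun i => Nat.card {a // f a = i})]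
  simp only [Subtype.ext_iff]

end Counting

theorem card_subgroup_eq_of_subgroupZeta_eq {G G' : Type*} [Group G] [Finite G] [Group G']
    [Finite G'] (h : ∀ s : ℂ, subgroupZeta G s = subgroupZeta G' s) (n : ℕ) :
    Nat.card {H : Subgroup G // Nat.card H = n} =
      Nat.card {H : Subgroup G' // Nat.card H = n} := by
  have := card_fiber_eq_of_pow_sums (fun H : Subgroup G => (Nat.card H : ℂ))
    (fun H : Subgroup G' => (Nat.card H : ℂ))
    (fun k => by simpa [subgroupZeta] using h (-k)) n
  simpa only [Nat.cast_inj] using this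

/-! ### Counting homomorphisms between finite abelian groups. -/

section Hom

instance MonoidHom.finite_of_finite {A G : Type*} [Group A] [Finite A] [Group G] [Finite G] :
    Finite (A →* G) :=
  Finite.of_injective (fun f : A →* G => (f : A → G)) DFunLike.coe_injective

/-- Homomorphisms with kernel `K` correspond to injective homomorphisms on the quotient. -/
def homKerEquiv {A : Type*} (G : Type*) [CommGroup A] [CommGroup G] (K : Subgroup A) :
    {f : A →* G // f.ker = K} ≃ {f : A ⧸ K →* G // f.ker = ⊥} where
  toFun f := ⟨QuotientGroup.lift K f.1 f.2.ge, by
    rw [MonoidHom.ker_eq_bot_iff]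
    exact (QuotientGroup.injective_lift_iff K f.1 f.2.ge).2 f.2.symm⟩
  invFun f := ⟨f.1.comp (QuotientGroup.mk' K), by
    rw [← MonoidHom.comap_ker, f.2, MonoidHom.comap_bot, QuotientGroup.ker_mk']⟩
  left_inv f := by ext; rfl
  right_inv f := by
    apply Subtype.ext
    apply QuotientGroup.monoidHom_ext
    rfl

/-- Homomorphisms out of `ℤ/n` correspond to elements killed by `n`. -/
def zmodHomEquiv (G : Type*) [CommGroup G] (n : ℕ) :
    (Multiplicative (ZMod n) →* G) ≃ {g : G // g ^ n = 1} :=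
  (MonoidHom.toAdditiveRight (α := ZMod n) (β := G)).trans <|
  (ZMod.lift n).symm.trans <|
    (zmultiplesHom (Additive G)).symm.subtypeEquiv fun f => by
      have hf : f n = n • f 1 := by rw [← map_nsmul, nsmul_one]
      rw [hf]
      exact Iff.rfl

variable {G G' : Type*} [CommGroup G] [Finite G] [CommGroup G'] [Finite G']

theorem card_pow_eq_one_eq_sum_divisors (H : Type*) [Group H] [Finite H] {n : ℕ} (hn : n ≠ 0) :
    Nat.card {g : H // g ^ n = 1} = ∑ d ∈ n.divisors, Nat.card {g : H // orderOf g = d} := by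
  classical
  let := Fintype.ofFinite H
  simp only [Nat.card_eq_fintype_card, Fintype.card_subtype]
  exact (sum_card_orderOf_eq_card_pow_eq_one hn).symm

theorem card_pow_eq_one_eq (h : ∀ n, Nat.card {g : G // orderOf g = n} =
      Nat.card {g : G' // orderOf g = n}) {n : ℕ} (hn : n ≠ 0) :
    Nat.card {g : G // g ^ n = 1} = Nat.card {g : G' // g ^ n = 1} := by
  simp only [card_pow_eq_one_eq_sum_divisors _ hn, h]

theorem card_hom_eq (h : ∀ n, Nat.card {g : G // orderOf g = n} =
      Nat.card {g : G' // orderOf g = n}) (A : Type*) [CommGroup A] [Finite A] :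
    Nat.card (A →* G) = Nat.card (A →* G') := by
  classical
  obtain ⟨ι, _, n, hn, ⟨e⟩⟩ := CommGroup.equiv_prod_multiplicative_zmod_of_finite A
  rw [Nat.card_congr (e.monoidHomCongrLeftEquiv (N := G)),
    Nat.card_congr (e.monoidHomCongrLeftEquiv (N := G')),
     Nat.card_congr (Pi.monoidHomMulEquiv (fun i ↦ Multiplicative (ZMod (n i))) G).toEquiv,
    Nat.card_congr (Pi.monoidHomMulEquiv (fun i ↦ Multiplicative (ZMod (n i))) G').toEquiv,
    Nat.card_pi, Nat.card_pi]
  refine Finset.prod_congr rfl fun i _ => ?_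
  rw [Nat.card_congr (zmodHomEquiv G (n i)), Nat.card_congr (zmodHomEquiv G' (n i))]
  exact card_pow_eq_one_eq h (by have := hn i; omega)

/-- Sort all homomorphisms by kernel `K`. Those with `K ≠ ⊥` are embeddings of the smaller group `A
⧸ K`, known by induction; the total is known by `card_hom_eq`. -/
theorem card_injective_hom_eq (h : ∀ n, Nat.card {g : G // orderOf g = n} =
      Nat.card {g : G' // orderOf g = n}) (m : ℕ) : ∀ (A : Type*) [CommGroup A] [Finite A],
    Nat.card A = m →
    Nat.card {f : A →* G // f.ker = ⊥} = Nat.card {f : A →* G' // f.ker = ⊥} := by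
  induction m using Nat.strong_induction_on with
  | _ m ih =>
  intro A _ _ hA
  classical
  let := Fintype.ofFinite (Subgroup A)
  have h1 := card_hom_eq h A
  rw [Nat.card_eq_sum_card_fiber (MonoidHom.ker : (A →* G) → Subgroup A),
    Nat.card_eq_sum_card_fiber (MonoidHom.ker : (A →* G') → Subgroup A),
    ← Finset.add_sum_erase _ _ (Finset.mem_univ ⊥),
    ← Finset.add_sum_erase Finset.univ (fun K => Nat.card {f : A →* G' // f.ker = K})
      (Finset.mem_univ ⊥)] at h1
  refine Nat.add_right_cancel (h1.trans ?_)
  congr 1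
  refine (Finset.sum_congr rfl fun K hK => ?_).symm
  rw [Nat.card_congr (homKerEquiv G K), Nat.card_congr (homKerEquiv G' K)]
  refine ih _ ?_ (A ⧸ K) rfl
  have hK1 : 1 < Nat.card K := by
    rw [Subgroup.one_lt_card_iff_ne_bot]
    exact Finset.ne_of_mem_erase hK
  rw [← hA, Subgroup.card_eq_card_quotient_mul_card_subgroup K]
  exact lt_mul_of_one_lt_right Nat.card_pos hK1

/-- Finite abelian groups with the same number of elements of each order are isomorphic. -/
theorem nonempty_mulEquiv_of_card_orderOf_eq (h : ∀ n, Nat.card {g : G // orderOf g = n} =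
      Nat.card {g : G' // orderOf g = n}) : Nonempty (G ≃* G') := by
  have h1 := card_injective_hom_eq h _ G rfl
  have hcard : Nat.card G = Nat.card G' := by
    -- This exponent kills both groups.
    have h2 := card_pow_eq_one_eq h (n := Nat.card G * Nat.card G')
      (mul_ne_zero Nat.card_pos.ne' Nat.card_pos.ne')
    rwa [Nat.card_congr (Equiv.subtypeUnivEquiv fun g => by rw [pow_mul, pow_card_eq_one', one_pow]),
      Nat.card_congr (Equiv.subtypeUnivEquiv fun g => by
        rw [mul_comm, pow_mul, pow_card_eq_one', one_pow])] at h2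
  have : Nonempty {f : G →* G // f.ker = ⊥} :=
    ⟨⟨MonoidHom.id G, (MonoidHom.ker_eq_bot_iff _).2 injective_id⟩⟩
  have h2 : 0 < Nat.card {f : G →* G' // f.ker = ⊥} := h1 ▸ Nat.card_pos
  obtain ⟨⟨f, hf⟩⟩ := (Nat.card_pos_iff.1 h2).1
  exact ⟨MulEquiv.ofBijective f ((Nat.bijective_iff_injective_and_card f).2
    ⟨(MonoidHom.ker_eq_bot_iff f).1 hf, hcard⟩)⟩

end Hom

/-! ### Subgroups by order and exponent. -/

section Torsion

/-- The subgroup of elements killed by `n`. -/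
def torsionSubgroup (G : Type*) [CommGroup G] (n : ℕ) : Subgroup G := (powMonoidHom n).ker

theorem mem_torsionSubgroup {G : Type*} [CommGroup G] {n : ℕ} {g : G} :
    g ∈ torsionSubgroup G n ↔ g ^ n = 1 := Iff.rfl

theorem card_orderOf_torsionSubgroup (G : Type*) [CommGroup G] (n d : ℕ) :
    Nat.card {g : torsionSubgroup G n // orderOf g = d} =
      if d ∣ n then Nat.card {g : G // orderOf g = d} else 0 := by
  split_ifs with hd
  · refine Nat.card_congr ⟨fun g => ⟨g.1.1, by rw [Subgroup.orderOf_coe, g.2]⟩,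
      fun g => ⟨⟨g.1, mem_torsionSubgroup.2 (orderOf_dvd_iff_pow_eq_one.1 (g.2.symm ▸ hd))⟩,
        by rw [Subgroup.orderOf_mk, g.2]⟩, fun _ => rfl, fun _ => rfl⟩
  · have : IsEmpty {g : torsionSubgroup G n // orderOf g = d} := ⟨fun g => hd <| by
      rw [← g.2, ← Subgroup.orderOf_coe, orderOf_dvd_iff_pow_eq_one]
      exact g.1.2⟩
    exact Nat.card_of_isEmpty

/-- The number of subgroups of order `n` and exponent `m`. -/
noncomputable def subgroupCount (G : Type*) [Group G] (n m : ℕ) : ℕ :=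
  Nat.card {H : Subgroup G // Nat.card H = n ∧ Monoid.exponent H = m}

theorem subgroupCount_congr {G G' : Type*} [Group G] [Group G'] (e : G ≃* G') (n m : ℕ) :
    subgroupCount G n m = subgroupCount G' n m := by
  refine Nat.card_congr (e.mapSubgroup.toEquiv.subtypeEquiv fun H => ?_)
  have e' : H ≃* e.mapSubgroup H := e.subgroupMap H
  change _ ↔ Nat.card (e.mapSubgroup H) = n ∧ Monoid.exponent (e.mapSubgroup H) = m
  rw [Nat.card_congr e'.toEquiv, Monoid.exponent_eq_of_mulEquiv e']

theorem subgroupCount_torsionSubgroup (G : Type*) [CommGroup G] (n m : ℕ) :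
    subgroupCount (torsionSubgroup G m) n m = subgroupCount G n m := by
  have hle : ∀ H : Subgroup G, Monoid.exponent H = m → H ≤ torsionSubgroup G m := by
    intro H hH g hg
    have := Monoid.pow_exponent_eq_one (⟨g, hg⟩ : H)
    rw [hH] at this
    exact mem_torsionSubgroup.2 (congrArg Subtype.val this)
  refine Nat.card_congr (Equiv.ofBijective (fun H => ⟨H.1.map (torsionSubgroup G m).subtype, ?_⟩)
    ⟨?_, ?_⟩)
  · have e := H.1.equivMapOfInjective _ (torsionSubgroup G m).subtype_injective
    rw [← Nat.card_congr e.toEquiv, ← Monoid.exponent_eq_of_mulEquiv e]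
    exact H.2
  · intro H K hHK
    exact Subtype.ext (Subgroup.map_injective (torsionSubgroup G m).subtype_injective
      (congrArg Subtype.val hHK))
  · rintro ⟨H, h1, h2⟩
    have e := Subgroup.subgroupOfEquivOfLe (hle H h2)
    refine ⟨⟨H.subgroupOf (torsionSubgroup G m), ?_, ?_⟩, ?_⟩
    · rw [Nat.card_congr e.toEquiv, h1]
    · rw [Monoid.exponent_eq_of_mulEquiv e, h2]
    · exact Subtype.ext (Subgroup.map_subgroupOf_eq_of_le (hle H h2))

theorem card_subgroup_eq_sum_subgroupCount (G : Type*) [Group G] [Finite G] {n : ℕ}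
    (hn : n ≠ 0) : Nat.card {H : Subgroup G // Nat.card H = n} =
      ∑ m ∈ Finset.Icc 1 n, subgroupCount G n m := by
  rw [Nat.card_eq_sum_card_of_mem
    (fun H : {H : Subgroup G // Nat.card H = n} => Monoid.exponent H.1) (Finset.Icc 1 n)]
  · exact Finset.sum_congr rfl fun m _ => Nat.card_congr (Equiv.subtypeSubtypeEquivSubtypeInter
      (fun H : Subgroup G => Nat.card H = n) (fun H => Monoid.exponent H = m))
  · rintro ⟨H, rfl⟩
    exact Finset.mem_Icc.2 ⟨Nat.pos_of_ne_zero Monoid.exponent_ne_zero_of_finite,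
      Nat.le_of_dvd Nat.card_pos Group.exponent_dvd_nat_card⟩

/-- In an abelian group, order equal to exponent means cyclic; the fibre of `g ↦ zpowers g` over
such a subgroup is its set of generators. -/
theorem card_orderOf_eq_totient_mul_subgroupCount (G : Type*) [CommGroup G] [Finite G] (n : ℕ) :
    Nat.card {g : G // orderOf g = n} = n.totient * subgroupCount G n n := by
  classical
  let C := {H : Subgroup G // Nat.card H = n ∧ Monoid.exponent H = n}
  let : Fintype C := Fintype.ofFinite C
  let z : {g : G // orderOf g = n} → C := fun g => ⟨Subgroup.zpowers g.1, by
    rw [Nat.card_zpowers, g.2], by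
    rw [IsCyclic.exponent_eq_card, Nat.card_zpowers, g.2]⟩
  rw [Nat.card_eq_sum_card_fiber z, Finset.sum_const_nat (m := n.totient), mul_comm,
    Finset.card_univ, ← Nat.card_eq_fintype_card]
  · rfl
  rintro ⟨H, h1, h2⟩ -
  have hc : IsCyclic H := IsCyclic.iff_exponent_eq_card.2 (h2.trans h1.symm)
  let := Fintype.ofFinite H
  rw [← IsCyclic.card_orderOf_eq_totient (α := H) (d := n)
    (by rw [← Nat.card_eq_fintype_card, h1]), ← Fintype.card_subtype, ← Nat.card_eq_fintype_card]
  refine Nat.card_congr ⟨fun g => ⟨⟨g.1.1, ?_⟩, ?_⟩, fun g => ⟨⟨g.1.1, ?_⟩, ?_⟩,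
    fun _ => rfl, fun _ => rfl⟩
  · have hg : Subgroup.zpowers g.1.1 = H := congrArg Subtype.val g.2
    exact hg.le (Subgroup.mem_zpowers _)
  · rw [Subgroup.orderOf_mk, g.1.2]
  · rw [Subgroup.orderOf_coe, g.2]
  · refine Subtype.ext (Subgroup.eq_of_le_of_card_ge ?_ ?_)
    · exact Subgroup.zpowers_le.2 g.1.2
    · change Nat.card H ≤ Nat.card (Subgroup.zpowers g.1.1)
      rw [Nat.card_zpowers, h1, Subgroup.orderOf_coe, g.2]

end Torsion

theorem card_orderOf_eq_of_card_subgroup_eq {G G' : Type*} [CommGroup G] [Finite G]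
    [CommGroup G'] [Finite G'] (h : ∀ n, Nat.card {H : Subgroup G // Nat.card H = n} =
      Nat.card {H : Subgroup G' // Nat.card H = n}) (n : ℕ) :
    Nat.card {g : G // orderOf g = n} = Nat.card {g : G' // orderOf g = n} := by
  induction n using Nat.strong_induction_on with
  | _ n ih =>
  rw [card_orderOf_eq_totient_mul_subgroupCount, card_orderOf_eq_totient_mul_subgroupCount]
  -- For `n = 0` both sides vanish, since `Nat.totient 0 = 0`.
  obtain rfl | hn := eq_or_ne n 0
  · simp
  congr 1
  have hlt : ∀ m ∈ (Finset.Icc 1 n).erase n, subgroupCount G' n m = subgroupCount G n m := by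
    intro m hm
    obtain ⟨hmn, hm⟩ := Finset.mem_erase.1 hm
    rw [Finset.mem_Icc] at hm
    -- Element orders in the `m`-torsion divide `m < n`, so the induction hypothesis covers them
    -- all.
    obtain ⟨e⟩ : Nonempty (torsionSubgroup G' m ≃* torsionSubgroup G m) := by
      refine nonempty_mulEquiv_of_card_orderOf_eq fun d => ?_
      rw [card_orderOf_torsionSubgroup, card_orderOf_torsionSubgroup]
      split_ifs with hd
      · exact (ih d (by have := Nat.le_of_dvd hm.1 hd; omega)).symm
      · rfl
    rw [← subgroupCount_torsionSubgroup, subgroupCount_congr e, subgroupCount_torsionSubgroup]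
  have hmem : n ∈ Finset.Icc 1 n := Finset.mem_Icc.2 ⟨Nat.pos_of_ne_zero hn, le_rfl⟩
  have key := h n
  rw [card_subgroup_eq_sum_subgroupCount G hn, card_subgroup_eq_sum_subgroupCount G' hn,
    ← Finset.add_sum_erase _ _ hmem,
    ← Finset.add_sum_erase _ (fun m => subgroupCount G' n m) hmem,
    Finset.sum_congr rfl hlt] at key
  exact Nat.add_right_cancel key

theorem mainTheorem1 {G : Type*} {G' : Type*} [CommGroup G] [Finite G] [CommGroup G'] [Finite G']
    (h : ∀ s : ℂ, subgroupZeta G s = subgroupZeta G' s) :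
    Nonempty (G ≃* G') :=
  nonempty_mulEquiv_of_card_orderOf_eq
    (card_orderOf_eq_of_card_subgroup_eq (card_subgroup_eq_of_subgroupZeta_eq h))
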